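/- All spaces are complex. For a finite set $A\subset\mathbb N$ let $\ell_2(A)$ be the Euclidean space $\mathbb C^A$ and let $\mathscr K:\ell_2(A)\to\ell_2(A)$ be the Kalton–Peck map, $\mathscr K(x)_k=x_k\log\frac{\|x\|_2}{|x_k|}$ (and $\mathscr K(x)_k=0$ if $x_k=0$). Let $(A_n)_{n\in\mathbb N}$ be a partition of $\mathbb N$ into finite sets. The fragmented Kalton–Peck map $\Omega=\ell_2(\mathscr K_{|\ell_2(A_n)})$ sends $x=(x_n)_n$ in $X=\ell_2(\ell_2(A_n))$ to $\Omega(x)=(\mathscr K(x_n))_n\in\prod_n\ell_2(A_n)$. It is quasi-linear: it is homogeneous, and $\Omega(x+y)-\Omega(x)-\Omega(y)\in X$ with $\|\Omega(x+y)-\Omega(x)-\Omega(y)\|\le C(\|x\|+\|y\|)$ for all $x,y\in X$. For a linear subspace $B\subset X$ put $d_\Omega B=\{(w,z)\in\prod_n\ell_2(A_n)\times B:\ w-\Omega(z)\in X\}$ with the quasi-norm $\|(w,z)\|=\|w-\Omega(z)\|+\|z\|$. We say that $\Omega_{|B}$ is trivial if the exact sequence $0\to X\to d_\Omega B\to B\to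 0$, with maps $y\mapsto(y,0)$ and $(w,z)\mapsto z$, is trivial, i.e. if there is a bounded linear projection of $d_\Omega B$ onto the copy $\{(y,0):y\in X\}$ of $X$; and that $\Omega$ is trivial if this holds for $B=X$. Assume $\sup_n|A_n|=\infty$. Then $\Omega$ is not trivial, and $\Omega$ is strictly non-singular: every infinite-dimensional linear subspace $H\subset X$ contains an infinite-dimensional linear subspace $B\subset H$ such that $\Omega_{|B}$ is trivial, and $B$ can be taken closed if $H$ is closed. -/

import Mathlib

open scoped ENNReal

noncomputable section

namespace FragKP

section General

variable {E : ℕ → Type} [∀ n, NormedAddCommGroup (E n)] [∀ n, NormedSpace ℂ (E n)]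

variable (E) in
/-- A (complex) quasi-linear map on `ℓ₂(E n)`: a homogeneous map `Ω` with values in the ambient
vector space `∏ n, E n`, whose Cauchy differences `Ω (x + y) - Ω x - Ω y` lie in `ℓ₂(E n)` and
satisfy `‖Ω (x + y) - Ω x - Ω y‖ ≤ C (‖x‖ + ‖y‖)`. -/
structure QuasiLinearMap where
  toFun : lp E 2 → (∀ n, E n)
  map_smul' : ∀ (c : ℂ) (x : lp E 2), toFun (c • x) = c • toFun x
  quasi_additive' : ∃ C : ℝ, ∀ x y : lp E 2, ∃ u : lp E 2,
    (⇑u : ∀ n, E n) = toFun (x + y) - toFun x - toFun y ∧ ‖u‖ ≤ C * (‖x‖ + ‖y‖)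

namespace QuasiLinearMap

variable (Ω : QuasiLinearMap E)

lemma map_zero' : Ω.toFun 0 = 0 := by
  have h := Ω.map_smul' 0 0
  simpa using h

/-- The twisted sum (derived space) `{(w, z) : z ∈ B, w - Ω z ∈ ℓ₂(E n)}` generated by the
restriction of `Ω` to a subspace `B` of `ℓ₂(E n)`. -/
def derivedSpace (B : Submodule ℂ (lp E 2)) : Submodule ℂ ((∀ n, E n) × lp E 2) where
  carrier := {p | p.2 ∈ B ∧ Memℓp (p.1 - Ω.toFun p.2) 2}
  zero_mem' := by
    refine ⟨B.zero_mem, ?_⟩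
    have h : ((0 : (∀ n, E n) × lp E 2).1 - Ω.toFun (0 : (∀ n, E n) × lp E 2).2) = 0 := by
      simp [Ω.map_zero']
    rw [h]
    exact zero_memℓp
  add_mem' := by
    rintro ⟨w, z⟩ ⟨w', z'⟩ ⟨hz, hw⟩ ⟨hz', hw'⟩
    refine ⟨B.add_mem hz hz', ?_⟩
    obtain ⟨C, hC⟩ := Ω.quasi_additive'
    obtain ⟨u, hu, -⟩ := hC z z'
    have h : w + w' - Ω.toFun (z + z') =
        (w - Ω.toFun z) + (w' - Ω.toFun z') - (⇑u : ∀ n, E n) := by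
      rw [hu]; abel
    change Memℓp (w + w' - Ω.toFun (z + z')) 2
    rw [h]
    exact (hw.add hw').sub u.2
  smul_mem' := by
    rintro c ⟨w, z⟩ ⟨hz, hw⟩
    refine ⟨B.smul_mem c hz, ?_⟩
    change Memℓp (c • w - Ω.toFun (c • z)) 2
    rw [Ω.map_smul', ← smul_sub]
    exact hw.const_smul c

/-- The quasi-norm `‖(w, z)‖ = ‖w - Ω z‖ + ‖z‖` of the derived space. -/
def derivedNorm {B : Submodule ℂ (lp E 2)} (p : Ω.derivedSpace B) : ℝ :=
  ‖(⟨p.1.1 - Ω.toFun p.1.2, p.2.2⟩ : lp E 2)‖ + ‖p.1.2‖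

/-- The embedding `j y = (y, 0)` of `ℓ₂(E n)` into the derived space. -/
def derivedIncl (B : Submodule ℂ (lp E 2)) (y : lp E 2) : Ω.derivedSpace B :=
  ⟨((⇑y : ∀ n, E n), 0), B.zero_mem, by
    change Memℓp ((⇑y : ∀ n, E n) - Ω.toFun 0) 2
    rw [Ω.map_zero', sub_zero]
    exact y.2⟩

/-- The restriction of `Ω` to `B` is trivial when the exact sequence
`0 → ℓ₂(E n) → derivedSpace B → B → 0` is trivial, that is, when `j (ℓ₂(E n))` is complemented:
there is a bounded linear projection of the derived space onto it. -/
def IsTrivialOn (B : Submodule ℂ (lp E 2)) : Prop :=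
  ∃ P : Ω.derivedSpace B →ₗ[ℂ] lp E 2,
    (∀ y, P (Ω.derivedIncl B y) = y) ∧ ∃ C : ℝ, ∀ p, ‖P p‖ ≤ C * Ω.derivedNorm p

def IsTrivial : Prop := Ω.IsTrivialOn ⊤

/-- Every infinite-dimensional subspace `A` contains an infinite-dimensional subspace `B` such that
the restriction of `Ω` to `B` is trivial. Subspaces are arbitrary linear subspaces; if `A` is closed
then `B` is required to be closed, so that the notion is also the one for closed subspaces. -/
def IsStrictlyNonSingular : Prop :=
  ∀ A : Submodule ℂ (lp E 2), ¬ FiniteDimensional ℂ A →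
    ∃ B : Submodule ℂ (lp E 2), B ≤ A ∧ ¬ FiniteDimensional ℂ B ∧
      (IsClosed (A : Set (lp E 2)) → IsClosed (B : Set (lp E 2))) ∧ Ω.IsTrivialOn B

end QuasiLinearMap

end General

/-- The Kalton–Peck map `𝒦 x = x log (‖x‖ / |x|)` (and `0` where `x` vanishes) on `ℓ₂(ι)`, for a
finite index set `ι`. -/
def kaltonPeck {ι : Type} [Fintype ι] (x : EuclideanSpace ℂ ι) : EuclideanSpace ℂ ι :=
  WithLp.toLp 2 fun i => x i * (Real.log (‖x‖ / ‖x i‖) : ℂ)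

/-- The `ℓ₂`-sum `ℓ₂(Ω n)` of maps `Ω n` on the pieces, `x ↦ (Ω n (x n))ₙ`. -/
def ell2Map {E : ℕ → Type} [∀ n, NormedAddCommGroup (E n)] (Ω : ∀ n, E n → E n)
    (x : lp E 2) : ∀ n, E n := fun n => Ω n (x n)

lemma norm_log_sub_smul_le {G : Type} [NormedAddCommGroup G] [NormedSpace ℝ G] (v : G) (T : ℝ)
    (h : ‖v‖ ≤ T) : ‖(Real.log ‖v‖ - Real.log T) • v‖ ≤ T := by
  rcases eq_or_ne v 0 with rfl | hv
  · simpa using h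
  have hv' : 0 < ‖v‖ := norm_pos_iff.2 hv
  have hT : 0 < T := hv'.trans_le h
  have h1 : Real.log ‖v‖ ≤ Real.log T := Real.log_le_log hv' h
  have h2 : Real.log T - Real.log ‖v‖ ≤ T / ‖v‖ - 1 := by
    rw [← Real.log_div hT.ne' hv'.ne']
    exact Real.log_le_sub_one_of_pos (div_pos hT hv')
  rw [norm_smul, Real.norm_eq_abs, abs_of_nonpos (by linarith)]
  calc -(Real.log ‖v‖ - Real.log T) * ‖v‖ ≤ (T / ‖v‖ - 1) * ‖v‖ := by
        gcongr; linarith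
    _ = T - ‖v‖ := by field_simp
    _ ≤ T := by linarith

lemma norm_log_smul_add_le {G : Type} [NormedAddCommGroup G] [NormedSpace ℝ G] (x y : G) :
    ‖Real.log ‖x + y‖ • (x + y) - Real.log ‖x‖ • x - Real.log ‖y‖ • y‖ ≤ 3 * (‖x‖ + ‖y‖) := by
  set T := ‖x‖ + ‖y‖ with hT
  have h1 := norm_log_sub_smul_le (x + y) T (norm_add_le x y)
  have h2 := norm_log_sub_smul_le x T (by have := norm_nonneg y; linarith)
  have h3 := norm_log_sub_smul_le y T (by have := norm_nonneg x; linarith)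
  have e : Real.log ‖x + y‖ • (x + y) - Real.log ‖x‖ • x - Real.log ‖y‖ • y =
      (Real.log ‖x + y‖ - Real.log T) • (x + y) - (Real.log ‖x‖ - Real.log T) • x
        - (Real.log ‖y‖ - Real.log T) • y := by module
  rw [e]
  have h4 := norm_sub_le ((Real.log ‖x + y‖ - Real.log T) • (x + y)
    - (Real.log ‖x‖ - Real.log T) • x) ((Real.log ‖y‖ - Real.log T) • y)
  have h5 := norm_sub_le ((Real.log ‖x + y‖ - Real.log T) • (x + y))
    ((Real.log ‖x‖ - Real.log T) • x)
  linarith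

section Finite

variable {ι : Type} [Fintype ι]

lemma kaltonPeck_apply (x : EuclideanSpace ℂ ι) (i : ι) :
    kaltonPeck x i = Real.log ‖x‖ • x i - Real.log ‖x i‖ • x i := by
  simp only [kaltonPeck, Complex.real_smul]
  rcases eq_or_ne (x i) 0 with h | h
  · simp [h]
  have hx : x ≠ 0 := by rintro rfl; simp at h
  rw [Real.log_div (norm_ne_zero_iff.2 hx) (norm_ne_zero_iff.2 h)]
  push_cast
  ring

lemma kaltonPeck_smul (c : ℂ) (x : EuclideanSpace ℂ ι) :
    kaltonPeck (c • x) = c • kaltonPeck x := by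
  ext i
  rcases eq_or_ne c 0 with rfl | hc
  · simp [kaltonPeck]
  simp only [kaltonPeck, PiLp.smul_apply, smul_eq_mul, norm_smul, norm_mul]
  rw [mul_div_mul_left _ _ (norm_ne_zero_iff.2 hc), mul_assoc]

lemma norm_kaltonPeck_add_le (x y : EuclideanSpace ℂ ι) :
    ‖kaltonPeck (x + y) - kaltonPeck x - kaltonPeck y‖ ≤ 6 * (‖x‖ + ‖y‖) := by
  set u : EuclideanSpace ℂ ι :=
    Real.log ‖x + y‖ • (x + y) - Real.log ‖x‖ • x - Real.log ‖y‖ • y with hu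
  set v : EuclideanSpace ℂ ι := WithLp.toLp 2 fun i =>
    Real.log ‖x i + y i‖ • (x i + y i) - Real.log ‖x i‖ • x i - Real.log ‖y i‖ • y i with hv
  have e : kaltonPeck (x + y) - kaltonPeck x - kaltonPeck y = u - v := by
    ext i
    simp only [PiLp.sub_apply, kaltonPeck_apply, hu, hv, PiLp.smul_apply, PiLp.add_apply]
    abel
  have h1 : ‖u‖ ≤ 3 * (‖x‖ + ‖y‖) := norm_log_smul_add_le x y
  set a : EuclideanSpace ℝ ι := WithLp.toLp 2 fun i => ‖x i‖ with ha
  set b : EuclideanSpace ℝ ι := WithLp.toLp 2 fun i => ‖y i‖ with hb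
  have hna : ‖a‖ = ‖x‖ := by simp [EuclideanSpace.norm_eq, ha]
  have hnb : ‖b‖ = ‖y‖ := by simp [EuclideanSpace.norm_eq, hb]
  have h2 : ‖v‖ ≤ ‖(3 : ℝ) • (a + b)‖ := by
    rw [EuclideanSpace.norm_eq, EuclideanSpace.norm_eq]
    gcongr with i
    refine (norm_log_smul_add_le (x i) (y i)).trans ?_
    simp only [ha, hb, PiLp.smul_apply, PiLp.add_apply, smul_eq_mul]
    exact le_abs_self _
  have h3 : ‖(3 : ℝ) • (a + b)‖ ≤ 3 * (‖x‖ + ‖y‖) := by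
    rw [norm_smul, ← hna, ← hnb]
    norm_num
    exact norm_add_le a b
  rw [e]
  have := norm_sub_le u v
  linarith

end Finite

/-- The `ℓ₂`-fragmentation `ℓ₂(𝒦|_{ℓ₂(A n)})` of the Kalton–Peck map according to finite sets
`A n`, as a quasi-linear map on `ℓ₂(ℓ₂(A n))`. -/
def fragmentedKaltonPeck (A : ℕ → Finset ℕ) :
    QuasiLinearMap (fun n => EuclideanSpace ℂ (A n)) where
  toFun := ell2Map fun n => (kaltonPeck : EuclideanSpace ℂ (A n) → EuclideanSpace ℂ (A n))
  map_smul' c x := by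
    funext n
    exact kaltonPeck_smul c (x n)
  quasi_additive' := by
    refine ⟨12, fun x y => ?_⟩
    set N : (x : lp (fun n => EuclideanSpace ℂ (A n)) 2) → lp (fun _ : ℕ => ℝ) 2 := fun x =>
      ⟨fun n => ‖x n‖, by
        have h := (memℓp_gen_iff (p := 2) (by norm_num)).1 (lp.memℓp x)
        exact (memℓp_gen_iff (E := fun _ : ℕ => ℝ) (p := 2) (by norm_num)).2 (by simpa using h)⟩ with hN
    have hNn : ∀ x, ‖N x‖ = ‖x‖ := fun x => by
      rw [lp.norm_eq_tsum_rpow (by norm_num), lp.norm_eq_tsum_rpow (by norm_num)]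
      simp [hN]
    set f : ∀ n, EuclideanSpace ℂ (A n) := fun n =>
      kaltonPeck ((x + y) n) - kaltonPeck (x n) - kaltonPeck (y n) with hf
    set g : lp (fun _ : ℕ => ℝ) 2 := (6 : ℝ) • (N x + N y) with hg
    have hle : ∀ n, ‖f n‖ ≤ ‖g n‖ := fun n =>
      (norm_kaltonPeck_add_le (x n) (y n)).trans (le_abs_self _)
    have hm : Memℓp f 2 := by
      have h := lp.memℓp g
      rw [memℓp_gen_iff (by norm_num)] at h ⊢
      refine h.of_nonneg_of_le (fun n => by positivity) fun n => ?_
      exact Real.rpow_le_rpow (norm_nonneg _) (hle n) (by norm_num)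
    refine ⟨⟨f, hm⟩, rfl, ?_⟩
    have h1 : ‖(⟨f, hm⟩ : lp (fun n => EuclideanSpace ℂ (A n)) 2)‖ ≤ ‖g‖ := by
      refine lp.norm_mono (by norm_num) hle
    have h2 : ‖g‖ ≤ 6 * (‖x‖ + ‖y‖) := by
      rw [hg, norm_smul, ← hNn x, ← hNn y]
      norm_num
      exact norm_add_le _ _
    have := norm_nonneg x
    have := norm_nonneg y
    linarith

end FragKP

end

open scoped ENNReal

/-! Non-triviality: a bounded projection of the derived space yields, on each block, a linear map
`L` with `‖𝒦 x - L x‖ ≤ C ‖x‖`, where `C` does not depend on the block. As `𝒦` kills the unit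
vectors, `‖L eᵢ‖ ≤ C`, and suitable signs make `‖L (∑ εᵢ eᵢ)‖ ≤ C √N`, with `N` the block size. But
`𝒦` multiplies the sign vector by `log √N`, so `log √N ≤ 2 C` (`log_sqrt_card_le`), which fails for
large blocks.

Strict non-singularity: a gliding hump in `H` gives orthonormal `x k` that on each block reduce to
one main vector `x (J n)`, earlier vectors with small remainders, and zeros
(`exists_orthonormal_gliding`). On the `z` with `z = ∑ ⟨x k, z⟩ x k` blockwise, the linear map `∑ ⟨x
k, z⟩ Φ (x k)` stays within a multiple of `‖z‖` of `Ω z`: on a block the error of `Φ` on the finite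
sum charges the main term once and earlier terms with weights `k + 3`, which the smallness absorbs
(`sum_sq_gliding_le`). -/

namespace FragKP

/-! ### Sign averaging and the lower bound on one block. -/

section Signs

/-- Signs `ε i = ±1` can be chosen so that `‖∑ ε i • v i‖² ≤ ∑ ‖v i‖²`. -/
lemma exists_sign_norm_sum_sq_le {F ι : Type*} [NormedAddCommGroup F] [InnerProductSpace ℂ F]
    (v : ι → F) (s : Finset ι) :
    ∃ ε : ι → ℂ, (∀ i, ‖ε i‖ = 1) ∧ ‖∑ i ∈ s, ε i • v i‖ ^ 2 ≤ ∑ i ∈ s, ‖v i‖ ^ 2 := by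
  classical
  induction s using Finset.induction_on with
  | empty => exact ⟨1, by simp, by simp⟩
  | insert a s ha ih =>
    obtain ⟨ε, hε, h⟩ := ih
    have key : ∀ c : ℂ, ∑ i ∈ insert a s, Function.update ε a c i • v i =
        c • v a + ∑ i ∈ s, ε i • v i := fun c => by
      rw [Finset.sum_insert ha, Function.update_self]
      congr 1
      refine Finset.sum_congr rfl fun i hi => ?_
      rw [Function.update_of_ne (ne_of_mem_of_not_mem hi ha)]
    have hn : ∀ c : ℂ, ‖c‖ = 1 → ∀ i, ‖Function.update ε a c i‖ = 1 := fun c hc i => by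
      rcases eq_or_ne i a with rfl | hi
      · simpa using hc
      · rw [Function.update_of_ne hi, hε]
    have hp := parallelogram_law_with_norm_mul ℂ (∑ i ∈ s, ε i • v i) (v a)
    -- By the parallelogram law, the shorter of sum and difference has square at most `‖∑‖² + ‖v
    -- a‖²`.
    rcases le_total ‖∑ i ∈ s, ε i • v i + v a‖ ‖∑ i ∈ s, ε i • v i - v a‖ with hle | hle
    · refine ⟨Function.update ε a 1, hn 1 (by simp), ?_⟩
      rw [key, Finset.sum_insert ha, one_smul, add_comm (v a)]
      nlinarith [norm_nonneg (∑ i ∈ s, ε i • v i + v a)]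
    · refine ⟨Function.update ε a (-1), hn (-1) (by simp), ?_⟩
      rw [key, Finset.sum_insert ha, neg_one_smul, neg_add_eq_sub]
      nlinarith [norm_nonneg (∑ i ∈ s, ε i • v i - v a)]

variable {ι : Type} [Fintype ι]

lemma kaltonPeck_eq_smul_of_norm_eq_one {x : EuclideanSpace ℂ ι} (hx : ∀ i, ‖x i‖ = 1) :
    kaltonPeck x = (Real.log ‖x‖ : ℂ) • x := by
  ext i
  simp [kaltonPeck, hx, mul_comm]

lemma kaltonPeck_single [DecidableEq ι] (i : ι) :
    kaltonPeck (EuclideanSpace.single i (1 : ℂ)) = 0 := by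
  ext j
  rcases eq_or_ne j i with rfl | h <;> simp [kaltonPeck, *]

/-- A linear map at distance at most `C` from the Kalton–Peck map on `ℓ₂(ι)` forces
`log √|ι| ≤ 2 C`. -/
lemma log_sqrt_card_le {F : Type*} [NormedAddCommGroup F] [InnerProductSpace ℂ F] [Nonempty ι]
    (j : EuclideanSpace ℂ ι →ₗ[ℂ] F) (hj : ∀ x, ‖j x‖ = ‖x‖) (L : EuclideanSpace ℂ ι →ₗ[ℂ] F)
    {C : ℝ} (hL : ∀ x, ‖j (kaltonPeck x) - L x‖ ≤ C * ‖x‖) :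
    Real.log (√(Fintype.card ι)) ≤ 2 * C := by
  classical
  have hC : ∀ i, ‖L (EuclideanSpace.single i 1)‖ ≤ C := fun i => by
    simpa [kaltonPeck_single] using hL (EuclideanSpace.single i 1)
  have hC0 : 0 ≤ C := (norm_nonneg _).trans (hC (Classical.arbitrary ι))
  obtain ⟨ε, hε, h⟩ :=
    exists_sign_norm_sum_sq_le (fun i => L (EuclideanSpace.single i 1)) Finset.univ
  set x : EuclideanSpace ℂ ι := WithLp.toLp 2 ε with hx
  have hxn : ‖x‖ = √(Fintype.card ι) := by simp [EuclideanSpace.norm_eq, hx, hε]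
  have hxs : x = ∑ i, ε i • EuclideanSpace.single i (1 : ℂ) := by
    ext k
    simp [hx, Finset.sum_apply, Pi.single_apply]
  have hLx : ‖L x‖ ≤ C * ‖x‖ := by
    refine abs_le_of_sq_le_sq' ?_ (by positivity) |>.2
    rw [hxs, map_sum, ← hxs, mul_pow, hxn, Real.sq_sqrt (by positivity)]
    simp only [map_smul]
    refine h.trans ?_
    calc ∑ i, ‖L (EuclideanSpace.single i 1)‖ ^ 2 ≤ ∑ _i : ι, C ^ 2 := by
          gcongr with i
          exact hC i
      _ = C ^ 2 * Fintype.card ι := by simp [mul_comm]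
  have hpos : 0 < ‖x‖ := by
    rw [hxn]
    exact Real.sqrt_pos.2 (by exact_mod_cast Fintype.card_pos)
  have hK := hL x
  rw [kaltonPeck_eq_smul_of_norm_eq_one (x := x) hε, map_smul] at hK
  -- One `C` is the distance from `𝒦 x` to `L x`, the other bounds `L x`.
  have h1 : ‖(Real.log ‖x‖ : ℂ) • j x‖ ≤ 2 * C * ‖x‖ := by
    have := norm_le_norm_sub_add ((Real.log ‖x‖ : ℂ) • j x) (L x)
    linarith
  rw [norm_smul, hj, Complex.norm_real] at h1
  rw [← hxn]
  exact (le_abs_self _).trans (le_of_mul_le_mul_right h1 hpos)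

end Signs

/-! ### Non-triviality. -/

section NotTrivial

theorem not_isTrivial_fragmentedKaltonPeck (A : ℕ → Finset ℕ)
    (hsup : ⨆ n, ((A n).card : ℕ∞) = ⊤) : ¬ (fragmentedKaltonPeck A).IsTrivial := by
  set Ω := fragmentedKaltonPeck A
  rintro ⟨P, hP, C, hC⟩
  obtain ⟨N, hN⟩ := exists_nat_gt (Real.exp (2 * C) ^ 2)
  obtain ⟨n, hn⟩ : ∃ n, (N : ℕ∞) < (A n).card := by
    rw [← lt_iSup_iff, hsup]
    exact ENat.natCast_lt_top N
  have hn' : N < (A n).card := by exact_mod_cast hn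
  have : Nonempty (A n) := (Finset.card_pos.1 (by omega)).to_subtype
  let j : EuclideanSpace ℂ (A n) →ₗ[ℂ] lp (fun n => EuclideanSpace ℂ (A n)) 2 :=
    lp.lsingle (E := fun n => EuclideanSpace ℂ (A n)) 2 n
  have hjn : ∀ x, ‖j x‖ = ‖x‖ := fun x =>
    lp.norm_single (E := fun n => EuclideanSpace ℂ (A n)) (by norm_num) n x
  have hΩj : ∀ x, Ω.toFun (j x) = ⇑(j (kaltonPeck x)) := fun x => by
    funext m
    change kaltonPeck ((Pi.single n x : ∀ n, EuclideanSpace ℂ (A n)) m) =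
      (Pi.single n (kaltonPeck x) : ∀ n, EuclideanSpace ℂ (A n)) m
    rcases eq_or_ne m n with rfl | h
    · simp
    · simp only [Pi.single_eq_of_ne h]
      ext i
      simp [kaltonPeck]
  let g : EuclideanSpace ℂ (A n) →ₗ[ℂ] Ω.derivedSpace ⊤ :=
    LinearMap.codRestrict _ ((LinearMap.inr ℂ _ _).comp j) fun x => by
      refine ⟨trivial, ?_⟩
      change Memℓp (0 - Ω.toFun (j x)) 2
      rw [zero_sub, hΩj]
      exact (lp.memℓp _).neg
  -- The pair `(𝒦 x, x)` has quasi-norm exactly `‖x‖`, and `P` maps it to `𝒦 x + P (0, x)`; hence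
  -- the linear approximation `-P (0, ·)`.
  have key : ∀ x, ‖j (kaltonPeck x) - (-(P.comp g)) x‖ ≤ C * ‖x‖ := fun x => by
    have h := hC (Ω.derivedIncl ⊤ (j (kaltonPeck x)) + g x)
    rw [map_add, hP] at h
    have h2 : Ω.derivedNorm (Ω.derivedIncl ⊤ (j (kaltonPeck x)) + g x) = ‖x‖ := by
      unfold QuasiLinearMap.derivedNorm
      have e2 : (Ω.derivedIncl ⊤ (j (kaltonPeck x)) + g x).1.2 = j x := by
        change 0 + j x = j x
        rw [zero_add]
      have e1 : (Ω.derivedIncl ⊤ (j (kaltonPeck x)) + g x).1.1 -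
          Ω.toFun (Ω.derivedIncl ⊤ (j (kaltonPeck x)) + g x).1.2 = 0 := by
        rw [e2, hΩj]
        change ⇑(j (kaltonPeck x)) + 0 - _ = 0
        rw [add_zero, sub_self]
      have e3 : (⟨_, (Ω.derivedIncl ⊤ (j (kaltonPeck x)) + g x).2.2⟩ :
          lp (fun n => EuclideanSpace ℂ (A n)) 2) = 0 := lp.ext e1
      rw [e3, e2, norm_zero, zero_add, hjn]
    rw [h2] at h
    simpa using h
  have hlog := log_sqrt_card_le j hjn _ key
  have hcard : Real.exp (2 * C) < √(Fintype.card (A n)) := by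
    apply Real.lt_sqrt_of_sq_lt
    refine hN.trans ?_
    rw [Fintype.card_coe]
    exact_mod_cast hn'
  have := Real.log_lt_log (Real.exp_pos _) hcard
  rw [Real.log_exp] at this
  linarith

end NotTrivial

/-! ### Quasi-additivity on finite sums and the square-summed error. -/

section Estimates

/-- Terms are split off from index `0` upwards, so `y k` is charged at most once per split up to its
own; the weight grows with `k` but not with `m`. -/
lemma norm_map_sum_range_sub_le {V W : Type*} [NormedAddCommGroup V] [NormedAddCommGroup W]
    {f : V → W} (h0 : f 0 = 0) {C : ℝ} (hC : 0 ≤ C)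
    (hf : ∀ x y, ‖f (x + y) - f x - f y‖ ≤ C * (‖x‖ + ‖y‖)) (m : ℕ) (y : ℕ → V) :
    ‖f (∑ k ∈ Finset.range m, y k) - ∑ k ∈ Finset.range m, f (y k)‖ ≤
      C * ∑ k ∈ Finset.range m, (k + 2 : ℝ) * ‖y k‖ := by
  induction m generalizing y with
  | zero => simp [h0]
  | succ m ih =>
    simp only [Finset.sum_range_succ' _ m]
    set S := ∑ k ∈ Finset.range m, y (k + 1)
    have h1 := ih fun k => y (k + 1)
    have h2 := hf S (y 0)
    have h3 : ‖S‖ ≤ ∑ k ∈ Finset.range m, ‖y (k + 1)‖ := norm_sum_le _ _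
    have e : f (S + y 0) - (∑ k ∈ Finset.range m, f (y (k + 1)) + f (y 0)) =
        (f (S + y 0) - f S - f (y 0)) + (f S - ∑ k ∈ Finset.range m, f (y (k + 1))) := by abel
    rw [e]
    refine (norm_add_le _ _).trans ?_
    have h4 : ∑ k ∈ Finset.range m, (((k + 1 : ℕ) : ℝ) + 2) * ‖y (k + 1)‖ =
        ∑ k ∈ Finset.range m, (k + 2 : ℝ) * ‖y (k + 1)‖ +
          ∑ k ∈ Finset.range m, ‖y (k + 1)‖ := by
      rw [← Finset.sum_add_distrib]
      refine Finset.sum_congr rfl fun k _ => ?_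
      push_cast
      ring
    rw [h4]
    have h5 := mul_le_mul_of_nonneg_left h3 hC
    have h6 := mul_nonneg hC (norm_nonneg (y 0))
    push_cast
    linarith

/-- Splitting off the last term first leaves it with weight one. This matters because the main
vector of a block is not small. -/
lemma norm_map_sum_range_succ_sub_le {V W : Type*} [NormedAddCommGroup V] [NormedAddCommGroup W]
    {f : V → W} (h0 : f 0 = 0) {C : ℝ} (hC : 0 ≤ C)
    (hf : ∀ x y, ‖f (x + y) - f x - f y‖ ≤ C * (‖x‖ + ‖y‖)) (m : ℕ) (y : ℕ → V) :
    ‖f (∑ k ∈ Finset.range (m + 1), y k) - ∑ k ∈ Finset.range (m + 1), f (y k)‖ ≤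
      C * (‖y m‖ + ∑ k ∈ Finset.range m, (k + 3 : ℝ) * ‖y k‖) := by
  rw [Finset.sum_range_succ, Finset.sum_range_succ]
  set S := ∑ k ∈ Finset.range m, y k
  have h1 := norm_map_sum_range_sub_le h0 hC hf m y
  have h2 := hf S (y m)
  have h3 : ‖S‖ ≤ ∑ k ∈ Finset.range m, ‖y k‖ := norm_sum_le _ _
  have e : f (S + y m) - (∑ k ∈ Finset.range m, f (y k) + f (y m)) =
      (f (S + y m) - f S - f (y m)) + (f S - ∑ k ∈ Finset.range m, f (y k)) := by abel
  rw [e]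
  refine (norm_add_le _ _).trans ?_
  have h4 : ∑ k ∈ Finset.range m, ((k : ℝ) + 3) * ‖y k‖ =
      ∑ k ∈ Finset.range m, (k + 2 : ℝ) * ‖y k‖ + ∑ k ∈ Finset.range m, ‖y k‖ := by
    rw [← Finset.sum_add_distrib]
    refine Finset.sum_congr rfl fun k _ => ?_
    ring
  rw [h4]
  have h5 := mul_le_mul_of_nonneg_left h3 hC
  linarith

lemma sum_sq_gliding_le {c : ℕ → ℝ} {a : ℕ → ℕ → ℝ} {J : ℕ → ℕ} {R : ℝ}
    (hc : ∀ s : Finset ℕ, ∑ k ∈ s, c k ^ 2 ≤ R ^ 2)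
    (ha : ∀ k (s : Finset ℕ), ∑ n ∈ s, a k n ^ 2 ≤ 1)
    (hJ : ∀ (k : ℕ) (s : Finset ℕ),
      (k + 3 : ℝ) ^ 2 * ∑ n ∈ s with k < J n, a k n ^ 2 ≤ (1 / 2) ^ k) (s : Finset ℕ) :
    ∑ n ∈ s, (c (J n) * a (J n) n + ∑ k ∈ Finset.range (J n), (k + 3 : ℝ) * (c k * a k n)) ^ 2 ≤
      6 * R ^ 2 := by
  -- Grouping blocks by their main index `k` costs each `c k ^ 2` only once.
  have h1 : ∑ n ∈ s, (c (J n) * a (J n) n) ^ 2 ≤ R ^ 2 := by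
    rw [← Finset.sum_fiberwise_of_maps_to (t := s.image J)
      fun n hn => Finset.mem_image_of_mem J hn]
    refine (Finset.sum_le_sum fun k _ => ?_).trans (hc (s.image J))
    calc ∑ n ∈ s with J n = k, (c (J n) * a (J n) n) ^ 2
        = c k ^ 2 * ∑ n ∈ s with J n = k, a k n ^ 2 := by
          rw [Finset.mul_sum]
          refine Finset.sum_congr rfl fun n hn => ?_
          rw [(Finset.mem_filter.1 hn).2, mul_pow]
      _ ≤ c k ^ 2 := mul_le_of_le_one_right (sq_nonneg _) (ha k _)
  -- Cauchy–Schwarz isolates the coefficients; exchanging the sums then leaves a geometric series.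
  have h2 : ∑ n ∈ s, (∑ k ∈ Finset.range (J n), (k + 3 : ℝ) * (c k * a k n)) ^ 2 ≤
      2 * R ^ 2 := by
    calc ∑ n ∈ s, (∑ k ∈ Finset.range (J n), (k + 3 : ℝ) * (c k * a k n)) ^ 2
        ≤ ∑ n ∈ s, R ^ 2 * ∑ k ∈ Finset.range (J n), (k + 3 : ℝ) ^ 2 * a k n ^ 2 := by
          refine Finset.sum_le_sum fun n _ => ?_
          have h := Finset.sum_mul_sq_le_sq_mul_sq (Finset.range (J n)) c
            fun k => (k + 3 : ℝ) * a k n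
          calc (∑ k ∈ Finset.range (J n), (k + 3 : ℝ) * (c k * a k n)) ^ 2
              = (∑ k ∈ Finset.range (J n), c k * ((k + 3 : ℝ) * a k n)) ^ 2 := by
                congr 1
                exact Finset.sum_congr rfl fun k _ => by ring
            _ ≤ _ := h
            _ ≤ _ := by
                simp only [mul_pow]
                exact mul_le_mul_of_nonneg_right (hc _)
                  (Finset.sum_nonneg fun k _ => by positivity)
      _ = R ^ 2 * ∑ k ∈ Finset.range (s.sup J),
            (k + 3 : ℝ) ^ 2 * ∑ n ∈ s with k < J n, a k n ^ 2 := by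
          rw [← Finset.mul_sum]
          congr 1
          simp only [Finset.mul_sum]
          refine Finset.sum_comm' fun n k => ?_
          simp only [Finset.mem_range, Finset.mem_filter]
          exact ⟨fun h => ⟨h, h.2.trans_le (Finset.le_sup h.1)⟩, fun h => h.1⟩
      _ ≤ R ^ 2 * ∑ k ∈ Finset.range (s.sup J), (1 / 2 : ℝ) ^ k := by
          gcongr with k
          exact hJ k s
      _ ≤ R ^ 2 * 2 := by
          gcongr
          exact sum_geometric_two_le _
      _ = 2 * R ^ 2 := mul_comm _ _
  calc _ ≤ ∑ n ∈ s, (2 * (c (J n) * a (J n) n) ^ 2 +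
        2 * (∑ k ∈ Finset.range (J n), (k + 3 : ℝ) * (c k * a k n)) ^ 2) := by
        refine Finset.sum_le_sum fun n _ => ?_
        linarith [add_sq_le (a := c (J n) * a (J n) n)
          (b := ∑ k ∈ Finset.range (J n), (k + 3 : ℝ) * (c k * a k n))]
    _ ≤ 6 * R ^ 2 := by
        rw [Finset.sum_add_distrib, ← Finset.mul_sum, ← Finset.mul_sum]
        linarith

end Estimates

/-! ### The gliding hump. -/

section Selection

variable {E : ℕ → Type} [∀ n, NormedAddCommGroup (E n)]

lemma sum_norm_sq_le (x : lp E 2) (s : Finset ℕ) : ∑ n ∈ s, ‖x n‖ ^ 2 ≤ ‖x‖ ^ 2 := by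
  simpa using lp.sum_rpow_le_norm_rpow (p := 2) (by norm_num) x s

lemma exists_tail_sum_lt (x : lp E 2) {δ : ℝ} (hδ : 0 < δ) :
    ∃ b, ∀ s : Finset ℕ, (∀ n ∈ s, b ≤ n) → ∑ n ∈ s, ‖x n‖ ^ 2 < δ := by
  have hs : Summable fun n => ‖x n‖ ^ 2 := by
    simpa using (memℓp_gen_iff (p := 2) (by norm_num)).1 (lp.memℓp x)
  obtain ⟨t, ht⟩ := summable_iff_vanishing_norm.1 hs δ hδ
  refine ⟨t.sup id + 1, fun s h => (le_abs_self _).trans_lt (ht s ?_)⟩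
  rw [Finset.disjoint_left]
  intro n hn hnt
  have h1 := h n hn
  have h2 : n ≤ t.sup id := Finset.le_sup (f := id) hnt
  omega

variable [∀ n, InnerProductSpace ℂ (E n)]

/-- An infinite-dimensional subspace contains unit vectors orthogonal to finitely many given ones
and vanishing on finitely many blocks. -/
lemma exists_unit_orthogonal_vanishing [∀ n, FiniteDimensional ℂ (E n)]
    {H : Submodule ℂ (lp E 2)} (hH : ¬ FiniteDimensional ℂ H) (s : Finset (lp E 2)) (a : ℕ) :
    ∃ x ∈ H, ‖x‖ = 1 ∧ (∀ y ∈ s, inner ℂ y x = 0) ∧ ∀ n < a, x n = 0 := by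
  let f : lp E 2 →ₗ[ℂ] (s → ℂ) × (∀ n : Fin a, E n) :=
    (LinearMap.pi fun y : s => (innerSL ℂ (y : lp E 2)).toLinearMap).prod
      (LinearMap.pi fun n : Fin a => (LinearMap.proj (n : ℕ)).comp (lpSubmodule ℂ E 2).subtype)
  have hf : ¬ Function.Injective (f.domRestrict H) := fun h =>
    hH (FiniteDimensional.of_injective _ h)
  rw [← LinearMap.ker_eq_bot, Submodule.eq_bot_iff] at hf
  push Not at hf
  obtain ⟨⟨x, hxH⟩, hx, hx0⟩ := hf
  have hx0' : x ≠ 0 := fun h => hx0 (Subtype.ext h)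
  have hfx : f x = 0 := hx
  have h1 : ∀ y ∈ s, inner ℂ y x = 0 := fun y hy => congrFun (congrArg Prod.fst hfx) ⟨y, hy⟩
  have h2 : ∀ n < a, x n = 0 := fun n hn => congrFun (congrArg Prod.snd hfx) ⟨n, hn⟩
  refine ⟨((‖x‖ : ℂ)⁻¹) • x, H.smul_mem _ hxH, ?_, fun y hy => ?_, fun n hn => ?_⟩
  · exact norm_smul_inv_norm hx0'
  · rw [inner_smul_right, h1 y hy, mul_zero]
  · rw [lp.coeFn_smul, Pi.smul_apply, h2 n hn, smul_zero]

/-- A gliding hump: an orthonormal sequence in `H` in which `x k` vanishes on the blocks `n` with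
`J n < k` and is small on those with `k < J n`. -/
lemma exists_orthonormal_gliding [∀ n, FiniteDimensional ℂ (E n)]
    {H : Submodule ℂ (lp E 2)} (hH : ¬ FiniteDimensional ℂ H) :
    ∃ (x : ℕ → lp E 2) (J : ℕ → ℕ), (∀ k, x k ∈ H) ∧ Orthonormal ℂ x ∧
      (∀ n k, J n < k → x k n = 0) ∧ ∀ (k : ℕ) (s : Finset ℕ),
        (k + 3 : ℝ) ^ 2 * ∑ n ∈ s with k < J n, ‖x k n‖ ^ 2 ≤ (1 / 2) ^ k := by
  classical
  -- A triple `(x, a, b)` records a vector vanishing before block `a` and small from block `b` on;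
  -- `r` places the next window after the previous one.
  let P : lp E 2 × ℕ × ℕ → Prop := fun q => q.1 ∈ H ∧ ‖q.1‖ = 1 ∧ (∀ n < q.2.1, q.1 n = 0) ∧
    q.2.1 < q.2.2 ∧ ∀ s : Finset ℕ, (∀ n ∈ s, q.2.2 ≤ n) →
      ((q.2.1 : ℝ) + 3) ^ 2 * ∑ n ∈ s, ‖q.1 n‖ ^ 2 ≤ (1 / 2) ^ q.2.1
  let r : lp E 2 × ℕ × ℕ → lp E 2 × ℕ × ℕ → Prop := fun q q' =>
    inner ℂ q.1 q'.1 = 0 ∧ q.2.2 ≤ q'.2.1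
  obtain ⟨f, hP, hr⟩ := exists_seq_of_forall_finset_exists P r fun s _ => by
    obtain ⟨x, hxH, hx1, hxs, hxa⟩ := exists_unit_orthogonal_vanishing hH (s.image Prod.fst)
      (s.sup fun q => q.2.2)
    set a := s.sup fun q => q.2.2 with ha
    have hpos : (0 : ℝ) < ((a : ℝ) + 3) ^ 2 := by positivity
    obtain ⟨b, hb⟩ := exists_tail_sum_lt x (δ := (1 / 2) ^ a / ((a : ℝ) + 3) ^ 2) (by positivity)
    refine ⟨(x, a, max b (a + 1)), ⟨hxH, hx1, hxa, by simp, fun t ht => ?_⟩, fun q hq =>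
      ⟨hxs _ (Finset.mem_image_of_mem _ hq), Finset.le_sup (f := fun q => q.2.2) hq⟩⟩
    have := hb t fun n hn => (le_max_left _ _).trans (ht n hn)
    rw [lt_div_iff₀ hpos] at this
    change ((a : ℝ) + 3) ^ 2 * ∑ n ∈ t, ‖x n‖ ^ 2 ≤ (1 / 2) ^ a
    linarith
  have hmono : StrictMono fun k => (f k).2.1 := strictMono_nat_of_lt_succ fun k =>
    (hP k).2.2.2.1.trans_le (hr k (k + 1) (Nat.lt_succ_self k)).2
  have hle : ∀ k, k ≤ (f k).2.1 := fun _ => hmono.le_apply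
  -- `J n` is the last `k` whose window has started by block `n`. Searching up to `n` suffices since
  -- `k` is at most the start of its window; the default `0` is harmless, as `k < J n` excludes it.
  refine ⟨fun k => (f k).1, fun n => Nat.findGreatest (fun k => (f k).2.1 ≤ n) n,
    fun k => (hP k).1, ⟨fun k => (hP k).2.1, fun i k hik => ?_⟩, fun n k hk => ?_, fun k s => ?_⟩
  · rcases hik.lt_or_gt with h | h
    · exact (hr i k h).1
    · exact inner_eq_zero_symm.1 (hr k i h).1
  · refine (hP k).2.2.1 n ?_
    by_contra! h
    exact Nat.findGreatest_is_greatest hk ((hle k).trans h) h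
  · have h := (hP k).2.2.2.2
      (s.filter fun n => k < Nat.findGreatest (fun k => (f k).2.1 ≤ n) n) fun n hn => by
        have hk := (Finset.mem_filter.1 hn).2
        have h1 : (f (Nat.findGreatest (fun k => (f k).2.1 ≤ n) n)).2.1 ≤ n :=
          Nat.findGreatest_of_ne_zero (P := fun k => (f k).2.1 ≤ n) rfl (by omega)
        exact (hr k _ hk).2.trans h1
    refine le_trans (mul_le_mul_of_nonneg_right ?_ (Finset.sum_nonneg fun _ _ => by positivity))
      (h.trans (pow_le_pow_of_le_one (by norm_num) (by norm_num) (hle k)))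
    have : (k : ℝ) ≤ (f k).2.1 := by exact_mod_cast hle k
    gcongr

end Selection

/-! ### Strict non-singularity. -/

section NonSingular

/-- The projection is `(w, z) ↦ w - L z`. `L` only takes values in the product, so no continuity is
needed. -/
lemma QuasiLinearMap.isTrivialOn_of_linear {E : ℕ → Type} [∀ n, NormedAddCommGroup (E n)]
    [∀ n, NormedSpace ℂ (E n)] (Ω : QuasiLinearMap E) (B : Submodule ℂ (lp E 2))
    (L : lp E 2 →ₗ[ℂ] ∀ n, E n) {C : ℝ}
    (h : ∀ z ∈ B, ∃ u : lp E 2, (⇑u : ∀ n, E n) = Ω.toFun z - L z ∧ ‖u‖ ≤ C * ‖z‖) :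
    Ω.IsTrivialOn B := by
  have hsplit : ∀ p : Ω.derivedSpace B, p.1.1 - L p.1.2 =
      (p.1.1 - Ω.toFun p.1.2) + (Ω.toFun p.1.2 - L p.1.2) := fun p => by abel
  have hmem : ∀ p : Ω.derivedSpace B, Memℓp (p.1.1 - L p.1.2) 2 := fun p => by
    obtain ⟨u, hu, -⟩ := h p.1.2 p.2.1
    rw [hsplit, ← hu]
    exact p.2.2.add u.2
  refine ⟨{ toFun := fun p => ⟨p.1.1 - L p.1.2, hmem p⟩
            map_add' := fun p q => lp.ext ?_
            map_smul' := fun c p => lp.ext ?_ }, fun y => lp.ext ?_, max C 1, fun p => ?_⟩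
  · change p.1.1 + q.1.1 - L (p.1.2 + q.1.2) = (p.1.1 - L p.1.2) + (q.1.1 - L q.1.2)
    rw [map_add]
    abel
  · change c • p.1.1 - L (c • p.1.2) = c • (p.1.1 - L p.1.2)
    rw [map_smul, smul_sub]
  · change ⇑y - L 0 = ⇑y
    rw [map_zero, sub_zero]
  · obtain ⟨u, hu, hun⟩ := h p.1.2 p.2.1
    have e : (⟨p.1.1 - L p.1.2, hmem p⟩ : lp E 2) = ⟨p.1.1 - Ω.toFun p.1.2, p.2.2⟩ + u :=
      lp.ext (by
        change p.1.1 - L p.1.2 = p.1.1 - Ω.toFun p.1.2 + ⇑u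
        rw [hu, hsplit])
    change ‖(⟨p.1.1 - L p.1.2, hmem p⟩ : lp E 2)‖ ≤ max C 1 * (‖_‖ + _)
    rw [e]
    refine (norm_add_le _ _).trans ?_
    rw [mul_add]
    refine add_le_add (le_mul_of_one_le_left (norm_nonneg _) (le_max_right _ _)) (hun.trans ?_)
    exact mul_le_mul_of_nonneg_right (le_max_left _ _) (norm_nonneg _)

variable {E : ℕ → Type} [∀ n, NormedAddCommGroup (E n)] [∀ n, InnerProductSpace ℂ (E n)]

/-- An `ℓ₂`-sum of homogeneous maps with uniformly bounded Cauchy differences on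
finite-dimensional blocks is strictly non-singular. -/
theorem isStrictlyNonSingular_of_ell2Map [∀ n, FiniteDimensional ℂ (E n)]
    (Ω : QuasiLinearMap E) (Φ : ∀ n, E n → E n) (hΩ : Ω.toFun = ell2Map Φ)
    (hΦ : ∀ n (c : ℂ) x, Φ n (c • x) = c • Φ n x) {C : ℝ} (hC : 0 ≤ C)
    (hΦa : ∀ n x y, ‖Φ n (x + y) - Φ n x - Φ n y‖ ≤ C * (‖x‖ + ‖y‖)) :
    Ω.IsStrictlyNonSingular := by
  intro H hH
  obtain ⟨x, J, hxH, hx, hxJ, hxs⟩ := exists_orthonormal_gliding hH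
  -- With `v n k = x k n` this is the blockwise expansion along `x`; with `v n k = Φ n (x k n)` it
  -- is the linear approximation of `Ω`. The sums are finite on each block, so both are defined on
  -- the whole space.
  let S : (∀ n, ℕ → E n) → lp E 2 →ₗ[ℂ] ∀ n, E n := fun v => LinearMap.pi fun n =>
    ∑ k ∈ Finset.range (J n + 1), (innerSL ℂ (x k)).toLinearMap.smulRight (v n k)
  have hS : ∀ v z n, S v z n = ∑ k ∈ Finset.range (J n + 1), inner ℂ (x k) z • v n k :=
    fun v z n => by simp [S]
  let M : Submodule ℂ (lp E 2) :=
    LinearMap.eqLocus (lpSubmodule ℂ E 2).subtype (S fun n k => x k n)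
  have hM : ∀ z, z ∈ M ↔ ∀ n, z n = ∑ k ∈ Finset.range (J n + 1), inner ℂ (x k) z • x k n :=
    fun z => by
      refine LinearMap.mem_eqLocus.trans (funext_iff.trans ?_)
      exact forall_congr' fun n => Eq.congr_right (hS (fun n k => x k n) z n)
  have hMc : IsClosed (M : Set (lp E 2)) := by
    have : (M : Set (lp E 2)) = ⋂ n, {z : lp E 2 |
        z n = ∑ k ∈ Finset.range (J n + 1), inner ℂ (x k) z • x k n} := by
      ext z
      simp [hM]
    rw [this]
    refine isClosed_iInter fun n => isClosed_eq ?_ (by fun_prop)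
    exact (continuous_apply n).comp lp.uniformContinuous_coe.continuous
  have hxM : ∀ k, x k ∈ M := fun k => by
    rw [hM]
    intro n
    simp only [orthonormal_iff_ite.1 hx, ite_smul, one_smul, zero_smul, Finset.sum_ite_eq',
      Finset.mem_range]
    split_ifs with h
    · rfl
    · exact hxJ n k (by omega)
  refine ⟨H ⊓ M, inf_le_left, fun hfin => ?_, fun hHc => hHc.inter hMc,
    Ω.isTrivialOn_of_linear _ (S fun n k => Φ n (x k n)) (C := 3 * C) fun z hz => ?_⟩
  · let y : ℕ → (H ⊓ M : Submodule ℂ (lp E 2)) := fun k => ⟨x k, hxH k, hxM k⟩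
    have hy : LinearIndependent ℂ y :=
      LinearIndependent.of_comp (H ⊓ M).subtype hx.linearIndependent
    exact not_finite_iff_infinite.2 inferInstance hy.finite
  · have hzM := (hM z).1 hz.2
    set c : ℕ → ℂ := fun k => inner ℂ (x k) z with hc
    set D : ∀ n, E n := Ω.toFun z - S (fun n k => Φ n (x k n)) z with hD
    have hDn : ∀ n, ‖D n‖ ≤ C * (‖c (J n)‖ * ‖x (J n) n‖ +
        ∑ k ∈ Finset.range (J n), (k + 3 : ℝ) * (‖c k‖ * ‖x k n‖)) := fun n => by
      have h0 : Φ n 0 = 0 := by simpa using hΦ n 0 0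
      have h := norm_map_sum_range_succ_sub_le h0 hC (hΦa n) (J n) fun k => c k • x k n
      have e : D n = Φ n (∑ k ∈ Finset.range (J n + 1), c k • x k n) -
          ∑ k ∈ Finset.range (J n + 1), Φ n (c k • x k n) := by
        rw [hD, Pi.sub_apply, hS, hΩ, ell2Map, ← hzM n]
        simp only [hΦ, hc]
      rw [e]
      simpa only [norm_smul] using h
    have hsum : ∀ s : Finset ℕ, ∑ n ∈ s, ‖D n‖ ^ 2 ≤ (3 * C * ‖z‖) ^ 2 := fun s => by
      have h := sum_sq_gliding_le (c := fun k => ‖c k‖) (a := fun k n => ‖x k n‖) (J := J)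
        (R := ‖z‖) (fun s => hx.sum_inner_products_le z)
        (fun k s => by simpa [hx.1 k] using sum_norm_sq_le (x k) s) hxs s
      calc ∑ n ∈ s, ‖D n‖ ^ 2 ≤ ∑ n ∈ s, C ^ 2 * (‖c (J n)‖ * ‖x (J n) n‖ +
            ∑ k ∈ Finset.range (J n), (k + 3 : ℝ) * (‖c k‖ * ‖x k n‖)) ^ 2 := by
            refine Finset.sum_le_sum fun n _ => ?_
            rw [← mul_pow]
            exact pow_le_pow_left₀ (norm_nonneg _) (hDn n) 2
        _ ≤ C ^ 2 * (6 * ‖z‖ ^ 2) := by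
            rw [← Finset.mul_sum]
            exact mul_le_mul_of_nonneg_left h (sq_nonneg C)
        -- Here `6 ≤ 3 ^ 2` accounts for the constant `3 * C`.
        _ ≤ (3 * C * ‖z‖) ^ 2 := by nlinarith [sq_nonneg (C * ‖z‖)]
    have hmem : Memℓp D 2 := memℓp_gen' (C := (3 * C * ‖z‖) ^ 2) (by simpa using hsum)
    refine ⟨⟨D, hmem⟩, rfl, ?_⟩
    exact lp.norm_le_of_forall_sum_le (p := 2) (by norm_num) (by positivity)
      (by simpa using hsum)

end NonSingular

end FragKP

theorem proposition4p9 (A : ℕ → Finset ℕ)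
    (hdisj : Pairwise fun m n => Disjoint (A m) (A n))
    (hcover : ∀ k : ℕ, ∃ n, k ∈ A n)
    (hsup : ⨆ n, ((A n).card : ℕ∞) = ⊤) :
    ¬ (FragKP.fragmentedKaltonPeck A).IsTrivial ∧
      (FragKP.fragmentedKaltonPeck A).IsStrictlyNonSingular := by
  refine ⟨FragKP.not_isTrivial_fragmentedKaltonPeck A hsup, ?_⟩
  exact FragKP.isStrictlyNonSingular_of_ell2Map (FragKP.fragmentedKaltonPeck A)
    (fun _ => FragKP.kaltonPeck) rfl (fun _ => FragKP.kaltonPeck_smul) (C := 6) (by norm_num)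
    fun _ => FragKP.norm_kaltonPeck_add_le
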